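/- Let $G$ be a group and $k \ge 0$. An elementary Andrews--Curtis transformation of a $k$-tuple $(x_1,\dots,x_k)\in G^k$ replaces a single entry $x_i$ by one of $x_i x_j^{\pm1}$ or $x_j^{\pm1}x_i$ with $j\neq i$, by $x_i^{-1}$, or by $w^{-1}x_i w$ with $w\in G$. The Andrews--Curtis graph $\Delta_k(G,G)$ is the graph whose vertices are the $k$-tuples of elements of $G$ whose normal closure in $G$ is $G$; two distinct vertices are adjacent if one is obtained from the other by an elementary Andrews--Curtis transformation. The canonical epimorphism $G\to G/[G,G]$, applied entrywise, induces a map from the vertices of $\Delta_k(G,G)$ to the vertices of $\Delta_k(G/[G,G],\,G/[G,G])$. Theorem. Let $G$ be a finite soluble group that can be generated by $k$ elements. Then for every connected component $C$ of $\Delta_k(G/[G,G],\,G/[G,G])$, the subgraph of $\Delta_k(G,G)$ induced on the preimage of $C$ is connected (in particular, non-empty). Moreover, the graph $\Delta_{k+1}(G,G)$ is connected. -/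

import Mathlib

namespace AndrewsCurtis

/-- The elementary Andrews-Curtis transformations of `k`-tuples of elements of a group `G`:
`ACMove x y` means that `y` is obtained from `x` by one such transformation. -/
inductive ACMove {G : Type*} [Group G] {k : ℕ} (x : Fin k → G) : (Fin k → G) → Prop
  | mulRight (i j : Fin k) (hij : i ≠ j) : ACMove x (Function.update x i (x i * x j))
  | mulRightInv (i j : Fin k) (hij : i ≠ j) : ACMove x (Function.update x i (x i * (x j)⁻¹))
  | mulLeft (i j : Fin k) (hij : i ≠ j) : ACMove x (Function.update x i (x j * x i))
  | mulLeftInv (i j : Fin k) (hij : i ≠ j) : ACMove x (Function.update x i ((x j)⁻¹ * x i))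
  | inv (i : Fin k) : ACMove x (Function.update x i (x i)⁻¹)
  | conj (i : Fin k) (w : G) : ACMove x (Function.update x i (w⁻¹ * x i * w))

/-- The set `V_k(G, N)` of `k`-tuples that generate `N` as a normal subgroup of `G`,
that is, whose normal closure in `G` is `N`. -/
def ACVertex {G : Type*} [Group G] (k : ℕ) (N : Subgroup G) : Type _ :=
  {h : Fin k → G // Subgroup.normalClosure (Set.range h) = N}

/-- The Andrews-Curtis graph `Δ_k(G, N)`: distinct vertices are adjacent when one of them is
obtained from the other by an elementary Andrews-Curtis transformation. -/
def acGraph {G : Type*} [Group G] (k : ℕ) (N : Subgroup G) : SimpleGraph (ACVertex k N) :=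
  SimpleGraph.fromRel fun x y => ACMove x.1 y.1

/-- The map of vertices `V_k(G, G) → V_k(G/[G,G], G/[G,G])` induced by the canonical epimorphism
`G → G/[G,G]`. -/
def acAbelianize {G : Type*} [Group G] (k : ℕ) (x : ACVertex k (⊤ : Subgroup G)) :
    ACVertex k (⊤ : Subgroup (Abelianization G)) :=
  ⟨fun i => Abelianization.of (x.1 i), by
    have hs : Function.Surjective (Abelianization.of : G →* Abelianization G) :=
      Quotient.mk_surjective
    have h := Subgroup.map_normalClosure (Set.range x.1) (Abelianization.of : G →* _) hs
    rw [x.2, Subgroup.map_top_of_surjective _ hs, ← Set.range_comp] at h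
    exact h.symm⟩

end AndrewsCurtis

/-! Everything reduces to one rigidity statement: in a finite soluble group, a tuple congruent
modulo `[G, G]` to a generating tuple `x` is Andrews-Curtis equivalent to `x`
(`acEquiv_of_generating`). It is proved by induction on the order of `G`. For a minimal normal
subgroup `M ≤ [G, G]`, which is abelian by solubility, the equivalence holds in `G ⧸ M` and lifts,
leaving entrywise errors in `M`. Each error is removed either because it lies in the normal closure
of the other entries or by conjugating the entry (`acEquiv_update_mul_of_mem_minimal`).

Gaschütz' lemma (`exists_generating_lift`) supplies a generating tuple above each vertex over the
abelianization. This gives non-empty preimages, and a common target for two tuples whose images in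
the abelianization are equivalent (`acEquiv_of_abelianize`).

For `k + 1` entries it then suffices that the graph of the abelianization is connected: in a finite
abelian group generated by `k` elements, all generating `(k + 1)`-tuples are related by
transvections (`transvEquiv_of_exponent`). Coprime parts of the exponent are treated independently;
in the `p`-primary case a generator that is not a `p`-th power is moved into an entry and divided
out. -/

namespace AndrewsCurtis

open Function Relation

variable {G : Type*} [Group G] {k : ℕ}

/-! ### Andrews-Curtis moves and their behaviour under homomorphisms -/

/-- Andrews-Curtis equivalence: the existence of a chain of elementary transformations. -/
def ACEquiv (x y : Fin k → G) : Prop := ReflTransGen ACMove x y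

theorem ACMove.symm {x y : Fin k → G} (h : ACMove x y) : ACMove y x := by
  cases h with
  | mulRight i j hij =>
    have := ACMove.mulRightInv (x := update x i (x i * x j)) i j hij
    simpa [hij.symm] using this
  | mulRightInv i j hij =>
    have := ACMove.mulRight (x := update x i (x i * (x j)⁻¹)) i j hij
    simpa [hij.symm] using this
  | mulLeft i j hij =>
    have := ACMove.mulLeftInv (x := update x i (x j * x i)) i j hij
    simpa [hij.symm] using this
  | mulLeftInv i j hij =>
    have := ACMove.mulLeft (x := update x i ((x j)⁻¹ * x i)) i j hij
    simpa [hij.symm] using this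
  | inv i =>
    have := ACMove.inv (x := update x i (x i)⁻¹) i
    simpa using this
  | conj i w =>
    have := ACMove.conj (x := update x i (w⁻¹ * x i * w)) i w⁻¹
    simpa [mul_assoc] using this

theorem ACEquiv.refl (x : Fin k → G) : ACEquiv x x := ReflTransGen.refl

theorem ACEquiv.trans {x y z : Fin k → G} (h : ACEquiv x y) (h' : ACEquiv y z) : ACEquiv x z :=
  ReflTransGen.trans h h'

theorem ACEquiv.symm {x y : Fin k → G} (h : ACEquiv x y) : ACEquiv y x :=
  (@ReflTransGen.stdSymm _ _ ⟨fun _ _ => ACMove.symm⟩).symm _ _ h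

theorem ACMove.equiv {x y : Fin k → G} (h : ACMove x y) : ACEquiv x y := ReflTransGen.single h

theorem ACMove.range_subset {x y : Fin k → G} (h : ACMove x y) :
    Set.range y ⊆ Subgroup.normalClosure (Set.range x) := by
  have hx : ∀ l, x l ∈ Subgroup.normalClosure (Set.range x) := fun l =>
    Subgroup.subset_normalClosure ⟨l, rfl⟩
  have hu : ∀ (i : Fin k) (a : G), a ∈ Subgroup.normalClosure (Set.range x) →
      Set.range (update x i a) ⊆ Subgroup.normalClosure (Set.range x) := by
    rintro i a ha _ ⟨l, rfl⟩
    rcases eq_or_ne l i with rfl | hl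
    · simpa using ha
    · simpa [hl] using hx l
  cases h with
  | mulRight i j hij => exact hu _ _ (mul_mem (hx i) (hx j))
  | mulRightInv i j hij => exact hu _ _ (mul_mem (hx i) (inv_mem (hx j)))
  | mulLeft i j hij => exact hu _ _ (mul_mem (hx j) (hx i))
  | mulLeftInv i j hij => exact hu _ _ (mul_mem (inv_mem (hx j)) (hx i))
  | inv i => exact hu _ _ (inv_mem (hx i))
  | conj i w =>
    refine hu _ _ ?_
    simpa using Subgroup.normalClosure_normal.conj_mem _ (hx i) w⁻¹

theorem ACMove.normalClosure_eq {x y : Fin k → G} (h : ACMove x y) :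
    Subgroup.normalClosure (Set.range y) = Subgroup.normalClosure (Set.range x) :=
  le_antisymm (Subgroup.normalClosure_le_normal h.range_subset)
    (Subgroup.normalClosure_le_normal h.symm.range_subset)

theorem ACMove.map {H : Type*} [Group H] (f : G →* H) {x y : Fin k → G} (h : ACMove x y) :
    ACMove (f ∘ x) (f ∘ y) := by
  cases h with
  | mulRight i j hij => simpa [comp_update] using ACMove.mulRight (x := f ∘ x) i j hij
  | mulRightInv i j hij => simpa [comp_update] using ACMove.mulRightInv (x := f ∘ x) i j hij
  | mulLeft i j hij => simpa [comp_update] using ACMove.mulLeft (x := f ∘ x) i j hij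
  | mulLeftInv i j hij => simpa [comp_update] using ACMove.mulLeftInv (x := f ∘ x) i j hij
  | inv i => simpa [comp_update] using ACMove.inv (x := f ∘ x) i
  | conj i w => simpa [comp_update] using ACMove.conj (x := f ∘ x) i (f w)

/-- Every move is given by a word in the entries, except that a conjugator is an arbitrary element
of the target; only there is surjectivity needed. -/
theorem ACMove.exists_lift {H : Type*} [Group H] {f : G →* H} (hf : Surjective f)
    {x : Fin k → G} {v : Fin k → H} (h : ACMove (f ∘ x) v) :
    ∃ y, ACMove x y ∧ f ∘ y = v := by
  cases h with
  | mulRight i j hij => exact ⟨_, .mulRight i j hij, by simp [comp_update]⟩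
  | mulRightInv i j hij => exact ⟨_, .mulRightInv i j hij, by simp [comp_update]⟩
  | mulLeft i j hij => exact ⟨_, .mulLeft i j hij, by simp [comp_update]⟩
  | mulLeftInv i j hij => exact ⟨_, .mulLeftInv i j hij, by simp [comp_update]⟩
  | inv i => exact ⟨_, .inv i, by simp [comp_update]⟩
  | conj i w =>
    obtain ⟨w, rfl⟩ := hf w
    exact ⟨_, .conj i w, by simp [comp_update]⟩

theorem ACEquiv.exists_lift {H : Type*} [Group H] {f : G →* H} (hf : Surjective f)
    {x : Fin k → G} {v : Fin k → H} (h : ACEquiv (f ∘ x) v) :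
    ∃ y, ACEquiv x y ∧ f ∘ y = v := by
  induction h with
  | refl => exact ⟨x, .refl x, rfl⟩
  | tail _ hm ih =>
    obtain ⟨y, hy, rfl⟩ := ih
    obtain ⟨z, hz, rfl⟩ := hm.exists_lift hf
    exact ⟨z, hy.trans hz.equiv, rfl⟩

/-- An entry may be multiplied by any element of the normal closure of the other entries. -/
theorem acEquiv_update_mul (x : Fin k → G) (i : Fin k) {g : G}
    (hg : g ∈ Subgroup.normalClosure (x '' {i}ᶜ)) (a : G) :
    ACEquiv (update x i a) (update x i (a * g)) := by
  induction hg using Subgroup.closure_induction generalizing a with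
  | mem g hg =>
    obtain ⟨_, ⟨j, hj, rfl⟩, hc⟩ := Group.mem_conjugatesOfSet_iff.1 hg
    obtain ⟨w, rfl⟩ := isConj_iff.1 hc
    have hj : j ≠ i := hj
    -- Conjugate entry `j` into the required conjugate, multiply entry `i` by it, then undo the
    -- conjugation (`h3`).
    have h1 := ACMove.conj (x := update x i a) j w⁻¹
    have h2 := ACMove.mulRight
      (x := update (update x i a) j ((w⁻¹)⁻¹ * update x i a j * w⁻¹)) i j hj.symm
    refine (h1.equiv.trans h2.equiv).trans ?_
    have h3 := (ACMove.conj (x := update x i (a * (w * x j * w⁻¹))) j w⁻¹).symm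
    convert h3.equiv using 1
    simp only [ne_eq, hj, not_false_eq_true, update_of_ne, hj.symm, update_self, inv_inv]
    rw [update_comm hj.symm]
    simpa using update_comm hj _ _ x
  | one => simpa using ACEquiv.refl _
  | mul g h _ _ ihg ihh => simpa [mul_assoc] using (ihg a).trans (ihh (a * g))
  | inv g _ ih => simpa using (ih (a * g⁻¹)).symm

/-- A reflexive transitive relation between tuples which allows one entry at a time to be replaced
relates any two tuples. -/
theorem rel_of_forall_update {ι α : Type*} [Fintype ι] [DecidableEq ι]
    (R : (ι → α) → (ι → α) → Prop) (hrefl : ∀ z, R z z)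
    (htrans : ∀ z z' z'', R z z' → R z' z'' → R z z'') (x y : ι → α)
    (h : ∀ z i, (∀ l, z l = x l ∨ z l = y l) → z i = x i → R z (update z i (y i))) : R x y := by
  -- Interpolate through the hybrid tuples that agree with `y` on `s` and with `x` elsewhere.
  have key : ∀ s : Finset ι, R x (s.piecewise y x) := by
    intro s
    induction s using Finset.induction_on with
    | empty => simpa using hrefl x
    | insert i s hi ih =>
      rw [Finset.piecewise_insert]
      refine htrans _ _ _ ih (h _ i (fun l => ?_) (by simp [hi]))
      by_cases hl : l ∈ s <;> simp [hl]
  simpa using key Finset.univ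

/-! ### Gaschütz' lemma by counting lifts -/

/-- The number of lifts of a generating tuple of a quotient that generate a given subgroup does
not depend on the generating tuple. -/
theorem ncard_lifts_closure_eq {G Q ι : Type*} [Group G] [Finite G] [Group Q] [Finite ι]
    (f : G →* Q) (q q' : ι → Q) (hq : Subgroup.closure (Set.range q) = ⊤)
    (hq' : Subgroup.closure (Set.range q') = ⊤) (H : Subgroup G) :
    {t : ι → G | f ∘ t = q ∧ Subgroup.closure (Set.range t) = H}.ncard =
      {t : ι → G | f ∘ t = q' ∧ Subgroup.closure (Set.range t) = H}.ncard := by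
  classical
  have := Fintype.ofFinite G
  have := Fintype.ofFinite ι
  have := Fintype.ofFinite (Subgroup G)
  induction H using WellFoundedLT.induction with
  | ind H ih =>
  by_cases hH : H.map f = ⊤
  -- Sort the lifts with entries in `H` by the subgroup they generate; the induction hypothesis
  -- handles all proper subgroups of `H`.
  · have split : ∀ q : ι → Q, {t : ι → G | f ∘ t = q ∧ ∀ i, t i ∈ H}.ncard =
        {t : ι → G | f ∘ t = q ∧ Subgroup.closure (Set.range t) = H}.ncard +
          ∑ K : Subgroup G with K < H,
            {t : ι → G | f ∘ t = q ∧ Subgroup.closure (Set.range t) = K}.ncard := by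
      intro q
      have e : {t : ι → G | f ∘ t = q ∧ ∀ i, t i ∈ H}.ncard =
          ∑ K ∈ insert H (Finset.univ.filter fun K : Subgroup G => K < H),
            {t : ι → G | f ∘ t = q ∧ Subgroup.closure (Set.range t) = K}.ncard := by
        simp only [Set.ncard_eq_toFinset_card']
        rw [Finset.card_eq_sum_card_fiberwise (f := fun t : ι → G => Subgroup.closure (Set.range t))
          (t := insert H (Finset.univ.filter fun K : Subgroup G => K < H))]
        · refine Finset.sum_congr rfl fun K hK => congrArg _ ?_
          have hKH : K ≤ H := by
            simp only [Finset.mem_insert, Finset.mem_filter, Finset.mem_univ, true_and] at hK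
            rcases hK with rfl | hK
            exacts [le_rfl, hK.le]
          ext t
          simp only [Finset.mem_filter, Set.mem_toFinset, Set.mem_ofPred_eq]
          refine ⟨fun h => ⟨h.1.1, h.2⟩, fun h => ⟨⟨h.1, fun i => hKH ?_⟩, h.2⟩⟩
          rw [← h.2]
          exact Subgroup.subset_closure ⟨i, rfl⟩
        · intro t ht
          simp only [Set.coe_toFinset, Set.mem_ofPred_eq] at ht
          have : Subgroup.closure (Set.range t) ≤ H := by
            rw [Subgroup.closure_le]
            rintro _ ⟨i, rfl⟩
            exact ht.2 i
          simpa using this.eq_or_lt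
      rw [e, Finset.sum_insert (by simp)]
    -- Since `H` maps onto `Q`, the lifts of `q` inside `H` form a coset of the tuples in `H ⊓
    -- f.ker`; translation matches those of `q` with those of `q'`.
    have heq : {t : ι → G | f ∘ t = q ∧ ∀ i, t i ∈ H}.ncard =
        {t : ι → G | f ∘ t = q' ∧ ∀ i, t i ∈ H}.ncard := by
      have lift : ∀ q : ι → Q, ∃ h : ι → G, f ∘ h = q ∧ ∀ i, h i ∈ H := by
        intro q
        have : ∀ i, ∃ g ∈ H, f g = q i := fun i => by
          simpa using (hH ▸ Subgroup.mem_top (q i) : q i ∈ H.map f)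
        choose h h1 h2 using this
        exact ⟨h, funext h2, h1⟩
      obtain ⟨h, rfl, hh⟩ := lift q
      obtain ⟨h', rfl, hh'⟩ := lift q'
      refine Set.ncard_congr (fun t _ => t * h⁻¹ * h') ?_ ?_ ?_
      · rintro t ⟨h1, h2⟩
        refine ⟨funext fun i => ?_, fun i => mul_mem (mul_mem (h2 i) (inv_mem (hh i))) (hh' i)⟩
        have := congrFun h1 i
        simp only [comp_apply] at this
        simp [this]
      · intro t t' _ _ e
        simpa using e
      · rintro t ⟨h1, h2⟩
        refine ⟨t * h'⁻¹ * h, ⟨funext fun i => ?_,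
          fun i => mul_mem (mul_mem (h2 i) (inv_mem (hh' i))) (hh i)⟩, by simp⟩
        have := congrFun h1 i
        simp only [comp_apply] at this
        simp [this]
    rw [split q, split q'] at heq
    rw [Finset.sum_congr rfl fun K hK => ih K (by simpa using hK)] at heq
    exact Nat.add_right_cancel heq
  -- A subgroup that does not map onto `Q` cannot be generated by a lift of a generating tuple, so
  -- both counts vanish.
  · have empty : ∀ q : ι → Q, Subgroup.closure (Set.range q) = ⊤ →
        {t : ι → G | f ∘ t = q ∧ Subgroup.closure (Set.range t) = H} = ∅ := by
      rintro q hq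
      refine Set.eq_empty_of_forall_notMem ?_
      rintro t ⟨rfl, rfl⟩
      rw [MonoidHom.map_closure, ← Set.range_comp] at hH
      exact hH hq
    rw [empty q hq, empty q' hq']

/-- **Gaschütz' lemma**: if a finite group has a generating tuple of a given length, then every
generating tuple of that length of a quotient lifts to a generating tuple. -/
theorem exists_generating_lift {G Q ι : Type*} [Group G] [Finite G] [Group Q] [Finite ι]
    {f : G →* Q} (hf : Surjective f) (hG : ∃ g : ι → G, Subgroup.closure (Set.range g) = ⊤)
    {q : ι → Q} (hq : Subgroup.closure (Set.range q) = ⊤) :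
    ∃ t : ι → G, f ∘ t = q ∧ Subgroup.closure (Set.range t) = ⊤ := by
  obtain ⟨g, hg⟩ := hG
  have hfg : Subgroup.closure (Set.range (f ∘ g)) = ⊤ := by
    rw [Set.range_comp, ← MonoidHom.map_closure, hg, Subgroup.map_top_of_surjective f hf]
  have h := ncard_lifts_closure_eq f (f ∘ g) q hfg hq ⊤
  have hpos : 0 < {t : ι → G | f ∘ t = f ∘ g ∧ Subgroup.closure (Set.range t) = ⊤}.ncard :=
    (Set.ncard_pos (Set.toFinite _)).2 ⟨g, rfl, hg⟩
  rw [h, Set.ncard_pos (Set.toFinite _)] at hpos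
  exact hpos

/-! ### Minimal normal subgroups and the soluble case -/

/-- An entry of a tuple that generates a finite group modulo an abelian minimal normal subgroup
`M ≤ [G, G]` may be multiplied by any element of `M`. -/
theorem acEquiv_update_mul_of_mem_minimal {G : Type*} [Group G] [Finite G] {k : ℕ}
    (M : Subgroup G) [M.Normal] (hmin : ∀ N : Subgroup G, N.Normal → N ≤ M → N = ⊥ ∨ N = M)
    (hab : ⁅M, M⁆ = ⊥) (hM : M ≤ commutator G) (z : Fin k → G)
    (hz : Subgroup.closure (Set.range z) ⊔ M = ⊤) (i : Fin k) {m : G} (hm : m ∈ M) :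
    ACEquiv z (update z i (z i * m)) := by
  set N := Subgroup.normalClosure (z '' {i}ᶜ) with hN
  have hNn : N.Normal := Subgroup.normalClosure_normal
  by_cases hMN : M ≤ N
  · simpa using acEquiv_update_mul z i (hMN hm) (z i)
  have hdis : M ⊓ N = ⊥ := (hmin (M ⊓ N) inferInstance inf_le_left).resolve_right
    fun h => hMN (inf_eq_left.1 h)
  have hMM : M ≤ Subgroup.centralizer (M : Set G) := by
    rwa [← Subgroup.commutator_eq_bot_iff_le_centralizer]
  have hNM : N ≤ Subgroup.centralizer (M : Set G) := by
    rw [← Subgroup.commutator_eq_bot_iff_le_centralizer, eq_bot_iff, ← hdis, inf_comm]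
    exact Subgroup.commutator_le_inf N M
  have hzj : ∀ j, j ≠ i → z j ∈ N := fun j hj => Subgroup.subset_normalClosure ⟨j, hj, rfl⟩
  rcases hmin (M ⊓ Subgroup.center G) inferInstance inf_le_left with hc | hc
  · -- the map `w ↦ [z i, w]` is a bijection of `M`
    have hmem : ∀ w ∈ M, (z i)⁻¹ * w⁻¹ * z i * w ∈ M := fun w hw => by
      refine mul_mem ?_ hw
      simpa using (inferInstance : M.Normal).conj_mem _ (inv_mem hw) (z i)⁻¹
    let φ : M → M := fun w => ⟨_, hmem w w.2⟩
    have hφ : Injective φ := by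
      rintro ⟨a, ha⟩ ⟨b, hb⟩ h
      have h : (z i)⁻¹ * a⁻¹ * z i * a = (z i)⁻¹ * b⁻¹ * z i * b := congrArg Subtype.val h
      have hcomm : z i * (a * b⁻¹) = a * b⁻¹ * z i := by
        have : a⁻¹ * (z i * (a * b⁻¹)) = a⁻¹ * (a * b⁻¹ * z i) := by
          calc a⁻¹ * (z i * (a * b⁻¹)) = z i * ((z i)⁻¹ * a⁻¹ * z i * a) * b⁻¹ := by group
            _ = a⁻¹ * (a * b⁻¹ * z i) := by rw [h]; group
        exact mul_left_cancel this
      have habM : a * b⁻¹ ∈ M := mul_mem ha (inv_mem hb)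
      -- `a * b⁻¹` commutes with `z i`, with the other entries (they lie in `N`) and with `M`;
      -- together these generate `G`.
      have htop : (⊤ : Subgroup G) ≤ Subgroup.centralizer {a * b⁻¹} := by
        rw [← hz, sup_le_iff, Subgroup.closure_le]
        have hsub : Subgroup.centralizer (M : Set G) ≤ Subgroup.centralizer {a * b⁻¹} :=
          Subgroup.centralizer_le (by simpa using habM)
        refine ⟨?_, hMM.trans hsub⟩
        rintro _ ⟨j, rfl⟩
        rcases eq_or_ne j i with rfl | hj
        · rw [SetLike.mem_coe, Subgroup.mem_centralizer_singleton_iff]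
          exact hcomm
        · exact hsub (hNM (hzj j hj))
      have hcen : a * b⁻¹ ∈ M ⊓ Subgroup.center G := by
        refine ⟨habM, Subgroup.mem_center_iff.2 fun g => ?_⟩
        exact Subgroup.mem_centralizer_singleton_iff.1 (htop (Subgroup.mem_top g))
      rw [hc, Subgroup.mem_bot, mul_inv_eq_one] at hcen
      exact Subtype.ext hcen
    obtain ⟨⟨w, hw⟩, hwm⟩ := Finite.injective_iff_surjective.1 hφ ⟨m, hm⟩
    have hwm : (z i)⁻¹ * w⁻¹ * z i * w = m := congrArg Subtype.val hwm
    have := (ACMove.conj (x := z) i w).equiv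
    rw [← hwm]
    convert this using 2
    group
  · -- the quotient by `N` is abelian
    exfalso
    have hcen : M ≤ Subgroup.center G := by rw [← hc]; exact inf_le_right
    refine hMN (hM.trans ?_)
    set q := QuotientGroup.mk' N with hq
    -- Modulo `N` only `z i` and the central subgroup `M` contribute generators, so `[G, G] ≤ N`,
    -- which forces `M ≤ N`.
    have hone : ∀ j, j ≠ i → q (z j) = 1 := fun j hj => by
      simpa [hq] using hzj j hj
    have hcomM : ∀ m ∈ M, ∀ g, q m * q g = q g * q m := fun m hm g => by
      rw [← map_mul, ← map_mul, Subgroup.mem_center_iff.1 (hcen hm) g]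
    have hcz : ∀ j l, q (z j) * q (z l) = q (z l) * q (z j) := fun j l => by
      rcases eq_or_ne j i with rfl | hj
      · rcases eq_or_ne l j with rfl | hl
        · rfl
        · simp [hone l hl]
      · simp [hone j hj]
    have hcl : ∀ j g, q (z j) * q g = q g * q (z j) := fun j g => by
      have : (⊤ : Subgroup G) ≤ (Subgroup.centralizer {q (z j)}).comap q := by
        rw [← hz, sup_le_iff, Subgroup.closure_le]
        constructor
        · rintro _ ⟨l, rfl⟩
          rw [SetLike.mem_coe, Subgroup.mem_comap, Subgroup.mem_centralizer_singleton_iff]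
          exact hcz _ _
        · intro m hm
          rw [Subgroup.mem_comap, Subgroup.mem_centralizer_singleton_iff]
          exact hcomM m hm _
      exact (Subgroup.mem_centralizer_singleton_iff.1 (this (Subgroup.mem_top g))).symm
    have hall : (⊤ : Subgroup G) ≤ (Subgroup.center (G ⧸ N)).comap q := by
      rw [← hz, sup_le_iff, Subgroup.closure_le]
      constructor
      · rintro _ ⟨l, rfl⟩
        refine Subgroup.mem_center_iff.2 fun g => ?_
        obtain ⟨g, rfl⟩ := QuotientGroup.mk'_surjective N g
        exact (hcl l g).symm
      · intro m hm
        refine Subgroup.mem_center_iff.2 fun g => ?_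
        obtain ⟨g, rfl⟩ := QuotientGroup.mk'_surjective N g
        exact (hcomM m hm g).symm
    rw [commutator_def, Subgroup.commutator_le]
    intro a _ b _
    have h := Subgroup.mem_center_iff.1 (hall (Subgroup.mem_top b)) (q a)
    rw [← QuotientGroup.ker_mk' N, MonoidHom.mem_ker, map_commutatorElement,
      commutatorElement_eq_one_iff_mul_comm]
    exact h

/-- A nontrivial normal subgroup of a finite group contains a minimal one. -/
theorem exists_minimal_normal {G : Type*} [Group G] [Finite G] (D : Subgroup G) [D.Normal]
    (hD : D ≠ ⊥) : ∃ M : Subgroup G, M.Normal ∧ M ≤ D ∧ M ≠ ⊥ ∧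
      ∀ N : Subgroup G, N.Normal → N ≤ M → N = ⊥ ∨ N = M := by
  obtain ⟨M, hMD, hM⟩ := exists_minimal_le_of_wellFoundedLT
    (fun N : Subgroup G => N.Normal ∧ N ≠ ⊥) D ⟨inferInstance, hD⟩
  refine ⟨M, hM.prop.1, hMD, hM.prop.2, fun N hN hNM => ?_⟩
  by_cases h : N = ⊥
  · exact .inl h
  · exact .inr (le_antisymm hNM (hM.le_of_le ⟨hN, h⟩ hNM))

/-- Otherwise `M` would be perfect, hence contained in every term of the derived series, which
reaches the trivial subgroup. -/
theorem commutator_minimal_eq_bot {G : Type*} [Group G] [Group.IsSolvable G] (M : Subgroup G)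
    [M.Normal] (hmin : ∀ N : Subgroup G, N.Normal → N ≤ M → N = ⊥ ∨ N = M) : ⁅M, M⁆ = ⊥ := by
  refine (hmin _ inferInstance (Subgroup.commutator_le_left M M)).elim id fun h => ?_
  have hd : ∀ n, M ≤ derivedSeries G n := by
    intro n
    induction n with
    | zero => simp
    | succ n ih =>
      rw [derivedSeries_succ, ← h]
      exact Subgroup.commutator_mono ih ih
  obtain ⟨n, hn⟩ := Group.IsSolvable.solvable (G := G)
  rw [h, eq_bot_iff, ← hn]
  exact hd n

/-- In a finite soluble group, a tuple congruent to a generating tuple modulo the commutator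
subgroup is equivalent to it. -/
theorem acEquiv_of_generating {G : Type*} [Group G] [Finite G] [Group.IsSolvable G] {k : ℕ}
    (x y : Fin k → G) (hx : Subgroup.closure (Set.range x) = ⊤)
    (hxy : Abelianization.of ∘ y = Abelianization.of ∘ x) : ACEquiv y x := by
  induction hn : Nat.card G using Nat.strong_induction_on generalizing G with
  | _ n ih =>
  have hxy' : ∀ l, (y l)⁻¹ * x l ∈ commutator G := fun l => by
    rw [← Abelianization.ker_of, MonoidHom.mem_ker, map_mul, map_inv, inv_mul_eq_one]
    exact congrFun hxy l
  by_cases hD : commutator G = ⊥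
  · have : y = x := funext fun l => by
      simpa [hD, inv_mul_eq_one] using hxy' l
    exact this ▸ .refl _
  obtain ⟨M, hMn, hMD, hM, hmin⟩ := exists_minimal_normal (commutator G) hD
  have hab := commutator_minimal_eq_bot M hmin
  have hs := QuotientGroup.mk'_surjective M
  have hcard : Nat.card (G ⧸ M) < n := by
    have h1 := M.card_eq_card_quotient_mul_card_subgroup
    have h2 : 1 < Nat.card M := by
      rwa [Subgroup.one_lt_card_iff_ne_bot]
    have h3 : 0 < Nat.card (G ⧸ M) := Nat.card_pos
    nlinarith
  have hq : ACEquiv (QuotientGroup.mk' M ∘ y) (QuotientGroup.mk' M ∘ x) := by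
    refine ih _ hcard _ _ ?_ ?_ rfl
    · rw [Set.range_comp, ← MonoidHom.map_closure, hx, Subgroup.map_top_of_surjective _ hs]
    · funext l
      have := congrArg (Abelianization.map (QuotientGroup.mk' M)) (congrFun hxy l)
      simpa using this
  obtain ⟨y', hy, hy'⟩ := hq.exists_lift hs
  refine hy.trans (rel_of_forall_update ACEquiv .refl (fun _ _ _ => .trans) y' x ?_)
  intro z i hz _
  have hzx : ∀ l, (x l)⁻¹ * z l ∈ M := fun l => by
    rcases hz l with h | h
    · rw [h, ← QuotientGroup.eq]
      exact (congrFun hy' l).symm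
    · simp [h]
  -- The hybrid tuple `z` need not generate `G`, but it does so modulo `M`, which is all that the
  -- single-entry correction requires.
  have hgen : Subgroup.closure (Set.range z) ⊔ M = ⊤ := by
    rw [eq_top_iff, ← hx, Subgroup.closure_le]
    rintro _ ⟨l, rfl⟩
    have : x l = z l * ((x l)⁻¹ * z l)⁻¹ := by group
    rw [this]
    exact mul_mem (Subgroup.mem_sup_left (Subgroup.subset_closure ⟨l, rfl⟩))
      (Subgroup.mem_sup_right (inv_mem (hzx l)))
  have := acEquiv_update_mul_of_mem_minimal M hmin hab hMD z hgen i
    (m := (z i)⁻¹ * x i) (by simpa using inv_mem (hzx i))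
  simpa using this

/-! ### Transvections on generating tuples of abelian groups -/

/-- `y` is obtained from the tuple `x` by multiplying one entry by a power of another one. -/
def TransvMove {A : Type*} [Group A] {n : ℕ} (x y : Fin n → A) : Prop :=
  ∃ i j : Fin n, i ≠ j ∧ ∃ c : ℤ, y = update x i (x i * x j ^ c)

/-- Equivalence of tuples under multiplication of entries by powers of other ones. -/
def TransvEquiv {A : Type*} [Group A] {n : ℕ} (x y : Fin n → A) : Prop :=
  ReflTransGen TransvMove x y

section Group

variable {A : Type*} [Group A] {n : ℕ}

theorem TransvMove.symm {x y : Fin n → A} (h : TransvMove x y) : TransvMove y x := by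
  obtain ⟨i, j, hij, c, rfl⟩ := h
  exact ⟨i, j, hij, -c, by simp [hij.symm]⟩

theorem TransvMove.equiv {x y : Fin n → A} (h : TransvMove x y) : TransvEquiv x y :=
  ReflTransGen.single h

theorem TransvEquiv.refl (x : Fin n → A) : TransvEquiv x x := ReflTransGen.refl

theorem TransvEquiv.trans {x y z : Fin n → A} (h : TransvEquiv x y) (h' : TransvEquiv y z) :
    TransvEquiv x z :=
  ReflTransGen.trans h h'

theorem TransvEquiv.symm {x y : Fin n → A} (h : TransvEquiv x y) : TransvEquiv y x :=
  (@ReflTransGen.stdSymm _ _ ⟨fun _ _ => TransvMove.symm⟩).symm _ _ h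

theorem TransvMove.closure_le {x y : Fin n → A} (h : TransvMove x y) :
    Subgroup.closure (Set.range y) ≤ Subgroup.closure (Set.range x) := by
  obtain ⟨i, j, hij, c, rfl⟩ := h
  have hx : ∀ l, x l ∈ Subgroup.closure (Set.range x) := fun l => Subgroup.subset_closure ⟨l, rfl⟩
  rw [Subgroup.closure_le]
  rintro _ ⟨l, rfl⟩
  rcases eq_or_ne l i with rfl | hl
  · simpa using mul_mem (hx l) (zpow_mem (hx j) c)
  · simpa [hl] using hx l

theorem TransvEquiv.closure_eq {x y : Fin n → A} (h : TransvEquiv x y) :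
    Subgroup.closure (Set.range x) = Subgroup.closure (Set.range y) := by
  induction h with
  | refl => rfl
  | tail _ hm ih => exact ih.trans (le_antisymm hm.symm.closure_le hm.closure_le)

theorem TransvEquiv.acEquiv {x y : Fin n → A} (h : TransvEquiv x y) : ACEquiv x y := by
  induction h with
  | refl => exact .refl _
  | tail _ hm ih =>
    refine ih.trans ?_
    rename_i y _ _
    obtain ⟨i, j, hij, c, rfl⟩ := hm
    have hj : y j ∈ Subgroup.normalClosure (y '' {i}ᶜ) :=
      Subgroup.subset_normalClosure ⟨j, hij.symm, rfl⟩
    simpa using acEquiv_update_mul y i (zpow_mem hj c) (y i)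

theorem TransvEquiv.cons {x y : Fin n → A} (h : TransvEquiv x y) (a : A) :
    TransvEquiv (Fin.cons a x : Fin (n + 1) → A) (Fin.cons a y) := by
  induction h with
  | refl => exact .refl _
  | tail _ hm ih =>
    refine ih.trans (TransvMove.equiv ?_)
    obtain ⟨i, j, hij, c, rfl⟩ := hm
    exact ⟨i.succ, j.succ, by simpa using hij, c, by simp [Fin.cons_update]⟩

/-- Equivalences lift along a homomorphism `f`. Given `r` such that the `r`-th power map
is compatible with `f` and killed by `g`, the lift can be chosen to have the same image under
`g`. -/
theorem TransvEquiv.exists_lift {B C : Type*} [Group B] [Group C] (f : A →* B) (g : A →* C) (r : ℤ)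
    (hf : ∀ a, f (a ^ r) = f a) (hg : ∀ a, g (a ^ r) = 1) {x : Fin n → A} {v : Fin n → B}
    (h : TransvEquiv (f ∘ x) v) : ∃ y, TransvEquiv x y ∧ f ∘ y = v ∧ g ∘ y = g ∘ x := by
  induction h with
  | refl => exact ⟨x, .refl x, rfl, rfl⟩
  | tail _ hm ih =>
    obtain ⟨y, hy, rfl, hgy⟩ := ih
    obtain ⟨i, j, hij, c, rfl⟩ := hm
    -- The exponent `r * c` acts as `c` under `f` and as `0` under `g`.
    refine ⟨update y i (y i * y j ^ (r * c)), hy.trans (TransvMove.equiv ⟨i, j, hij, _, rfl⟩),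
      ?_, ?_⟩
    · rw [comp_update, map_mul, zpow_mul, map_zpow, hf]
      rfl
    · rw [← hgy, comp_update, map_mul, zpow_mul, map_zpow, hg]
      simp

end Group

variable {A : Type*} [CommGroup A]

theorem transvEquiv_update_mul {n : ℕ} (x : Fin n → A) (i : Fin n) {g : A}
    (hg : g ∈ Subgroup.closure (x '' {i}ᶜ)) (a : A) :
    TransvEquiv (update x i a) (update x i (a * g)) := by
  induction hg using Subgroup.closure_induction generalizing a with
  | mem g hg =>
    obtain ⟨j, hj, rfl⟩ := hg
    have hj : j ≠ i := hj
    refine TransvMove.equiv ⟨i, j, hj.symm, 1, ?_⟩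
    simp [hj]
  | one => simpa using TransvEquiv.refl _
  | mul g h _ _ ihg ihh => simpa [mul_assoc] using (ihg a).trans (ihh (a * g))
  | inv g _ ih => simpa using (ih (a * g⁻¹)).symm

theorem zpow_eq_of_dvd_sub {a : A} {N : ℤ} (ha : a ^ N = 1) {s t : ℤ} (h : N ∣ s - t) :
    a ^ s = a ^ t := by
  obtain ⟨u, hu⟩ := h
  rw [show s = t + N * u by linarith, zpow_add, zpow_mul, ha, one_zpow, mul_one]

/-- In a tuple of elements of `p`-power order, an entry can be replaced by a product of powers of
the entries in which another exponent is prime to `p`. -/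
theorem exists_transvEquiv_prod {n : ℕ} {N : ℕ} (hN : ∀ a : A, a ^ N = 1) (x : Fin n → A)
    (c : Fin n → ℤ) {i j : Fin n} (hij : i ≠ j) (hc : IsCoprime (c j) N) :
    ∃ y, TransvEquiv x y ∧ y i = ∏ l, x l ^ c l := by
  obtain ⟨u, v, huv⟩ := hc
  -- Multiplying `x i` by `x' j ^ c j` contributes exponent `1 + t * c j` of `x i`; as `u * c j ≡ 1`
  -- modulo `N`, this choice of `t` makes it `c i`.
  set t := u * (c i - 1) with ht
  set x' := update x j (x j * x i ^ t) with hx'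
  have h1 : TransvEquiv x x' := TransvMove.equiv ⟨j, i, hij.symm, t, rfl⟩
  set h := ∏ l ∈ (Finset.univ.erase i).erase j, x l ^ c l with hh
  have hx'j : x' j = x j * x i ^ t := by simp [hx']
  have hx'i : x' i = x i := by simp [hx', hij]
  have hmem : x' j ^ c j * h ∈ Subgroup.closure (x' '' {i}ᶜ) := by
    have hsub : ∀ l, l ≠ i → x' l ∈ Subgroup.closure (x' '' {i}ᶜ) := fun l hl =>
      Subgroup.subset_closure ⟨l, hl, rfl⟩
    refine mul_mem (zpow_mem (hsub j hij.symm) _) (prod_mem fun l hl => ?_)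
    simp only [Finset.mem_erase] at hl
    have := hsub l hl.2.1
    rw [hx', update_of_ne hl.1] at this
    exact zpow_mem this _
  have h2 := transvEquiv_update_mul x' i hmem (x' i)
  rw [update_eq_self] at h2
  refine ⟨_, h1.trans h2, ?_⟩
  rw [update_self, hx'i, hx'j, ← Finset.mul_prod_erase Finset.univ _ (Finset.mem_univ i),
    ← Finset.mul_prod_erase (Finset.univ.erase i) _ (Finset.mem_erase.2 ⟨hij.symm, Finset.mem_univ j⟩),
    ← hh, mul_zpow, ← zpow_mul]
  have : x i ^ (1 + t * c j) = x i ^ c i := by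
    refine zpow_eq_of_dvd_sub (N := N) (by exact_mod_cast hN (x i)) ⟨-(v * (c i - 1)), ?_⟩
    rw [ht]
    linear_combination (c i - 1) * huv
  rw [← this, zpow_add, zpow_one]
  simp only [mul_assoc, mul_left_comm]

/-- In an abelian group of prime power exponent, an entry of a generating tuple of
length at least two can be replaced by any given element which is not a `p`-th power. -/
theorem exists_transvEquiv_apply_eq {n p e : ℕ} (hp : p.Prime) (hA : ∀ a : A, a ^ p ^ e = 1)
    {x : Fin n → A} (hx : Subgroup.closure (Set.range x) = ⊤) {a : A} (ha : ∀ b, b ^ p ≠ a)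
    {i j : Fin n} (hij : i ≠ j) : ∃ y, TransvEquiv x y ∧ y i = a := by
  obtain ⟨c, hc⟩ := Subgroup.exists_of_mem_closure_range x a (hx ▸ Subgroup.mem_top a)
  have hcop : ∀ s : ℤ, ¬ (p : ℤ) ∣ s → IsCoprime s ((p ^ e : ℕ) : ℤ) := fun s hs => by
    push_cast
    exact (((Nat.prime_iff_prime_int.1 hp).coprime_iff_not_dvd.2 hs).symm).pow_right
  by_cases h : ∃ l, l ≠ i ∧ ¬ (p : ℤ) ∣ c l
  · obtain ⟨l, hl, hpl⟩ := h
    rw [hc]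
    exact exists_transvEquiv_prod hA x c hl.symm (hcop _ hpl)
  push Not at h
  have hi : ¬ (p : ℤ) ∣ c i := by
    intro hi
    have hall : ∀ l, (p : ℤ) ∣ c l := fun l => by
      rcases eq_or_ne l i with rfl | hl
      exacts [hi, h l hl]
    choose d hd using hall
    refine ha (∏ l, x l ^ d l) ?_
    rw [hc, ← Finset.prod_pow]
    refine Finset.prod_congr rfl fun l _ => ?_
    rw [hd l, mul_comm, zpow_mul, zpow_natCast]
  -- Only `c i` is prime to `p`. Replacing `x i` by `x i * x j` and `c j` by `c j - c i` preserves
  -- the product and makes the exponent at `j` prime to `p`.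
  set x' := update x i (x i * x j ^ (1 : ℤ)) with hx'
  have h1 : TransvEquiv x x' := TransvMove.equiv ⟨i, j, hij, 1, rfl⟩
  have hprod : ∏ l, x' l ^ (update c j (c j - c i)) l = a := by
    rw [hc, ← Finset.mul_prod_erase Finset.univ _ (Finset.mem_univ i),
      ← Finset.mul_prod_erase (Finset.univ.erase i) _
        (Finset.mem_erase.2 ⟨hij.symm, Finset.mem_univ j⟩),
      ← Finset.mul_prod_erase Finset.univ (fun l => x l ^ c l) (Finset.mem_univ i),
      ← Finset.mul_prod_erase (Finset.univ.erase i) (fun l => x l ^ c l)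
        (Finset.mem_erase.2 ⟨hij.symm, Finset.mem_univ j⟩)]
    have : ∀ l ∈ (Finset.univ.erase i).erase j,
        x' l ^ (update c j (c j - c i)) l = x l ^ c l := fun l hl => by
      simp only [Finset.mem_erase] at hl
      simp [hx', hl.1, hl.2.1]
    rw [Finset.prod_congr rfl this, ← mul_assoc, ← mul_assoc]
    congr 1
    simp only [hx', update_self, hij, hij.symm, ne_eq, not_false_eq_true, update_of_ne, zpow_one,
      mul_zpow, zpow_sub]
    rw [mul_assoc, mul_comm (x j ^ c j), mul_inv_cancel_left]
  obtain ⟨y, hy, hya⟩ := exists_transvEquiv_prod hA x' hij (c := update c j (c j - c i))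
    (hcop _ (by
      rw [update_self]
      exact fun hd => hi ((dvd_sub_right (h j hij.symm)).1 hd)))
  exact ⟨y, h1.trans hy, hya.trans hprod⟩

theorem closure_range_mk_tail {A : Type*} [CommGroup A] {n : ℕ} {x : Fin (n + 1) → A}
    (hx : Subgroup.closure (Set.range x) = ⊤) :
    Subgroup.closure (Set.range (QuotientGroup.mk' (Subgroup.zpowers (x 0)) ∘ Fin.tail x)) = ⊤ := by
  set q := QuotientGroup.mk' (Subgroup.zpowers (x 0)) with hq
  rw [eq_top_iff, ← Subgroup.map_top_of_surjective q (QuotientGroup.mk'_surjective _), ← hx,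
    MonoidHom.map_closure, ← Set.range_comp, Subgroup.closure_le]
  rintro _ ⟨l, rfl⟩
  refine Fin.cases ?_ (fun l => ?_) l
  · have : q (x 0) = 1 := by simp [hq]
    simp [this]
  · exact Subgroup.subset_closure ⟨l, rfl⟩

/-- If an abelian group of prime power exponent is generated by `k` elements, then any two
generating `(k + 1)`-tuples are equivalent. -/
theorem transvEquiv_of_prime_pow {p e : ℕ} (hp : p.Prime) {A : Type*} [CommGroup A]
    (hA : ∀ a : A, a ^ p ^ e = 1) {k : ℕ} {a : Fin k → A}
    (ha : Subgroup.closure (Set.range a) = ⊤) {x y : Fin (k + 1) → A}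
    (hx : Subgroup.closure (Set.range x) = ⊤) (hy : Subgroup.closure (Set.range y) = ⊤) :
    TransvEquiv x y := by
  have trivial_case : (∀ b : A, b = 1) → TransvEquiv x y := fun h => by
    have : x = y := funext fun l => (h (x l)).trans (h (y l)).symm
    exact this ▸ .refl _
  induction k generalizing A with
  | zero =>
    refine trivial_case fun b => ?_
    have : b ∈ Subgroup.closure (Set.range a) := ha ▸ Subgroup.mem_top b
    simpa using this
  | succ k ih =>
    -- Either some generator is not a `p`-th power and can be placed in entry `0` of both tuples and
    -- divided out, or every element is a `p`-th power, hence a `p ^ e`-th power, hence trivial.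
    by_cases h : ∃ i, ∀ b, b ^ p ≠ a i
    · obtain ⟨i, hi⟩ := h
      set a' := a ∘ Equiv.swap 0 i with ha'
      have ha'0 : a' 0 = a i := by simp [ha']
      have ha'gen : Subgroup.closure (Set.range a') = ⊤ := by
        rwa [ha', EquivLike.range_comp]
      rw [← ha'0] at hi
      obtain ⟨x', hxx', hx'⟩ := exists_transvEquiv_apply_eq hp hA hx hi (i := 0) (j := 1) (by simp)
      obtain ⟨y', hyy', hy'⟩ := exists_transvEquiv_apply_eq hp hA hy hi (i := 0) (j := 1) (by simp)
      rw [hxx'.closure_eq] at hx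
      rw [hyy'.closure_eq] at hy
      have gx := closure_range_mk_tail hx
      have gy := closure_range_mk_tail hy
      rw [hx'] at gx
      rw [hy'] at gy
      set q := QuotientGroup.mk' (Subgroup.zpowers (a' 0)) with hq
      have hQ : ∀ b : A ⧸ Subgroup.zpowers (a' 0), b ^ p ^ e = 1 := fun b => by
        obtain ⟨b, rfl⟩ := QuotientGroup.mk'_surjective _ b
        rw [← map_pow, hA, map_one]
      have hxy : TransvEquiv (q ∘ Fin.tail x') (q ∘ Fin.tail y') :=
        ih hQ (closure_range_mk_tail ha'gen) gx gy fun h => by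
          have : q ∘ Fin.tail x' = q ∘ Fin.tail y' := funext fun l => (h _).trans (h _).symm
          exact this ▸ .refl _
      obtain ⟨u, hu, huy, -⟩ := hxy.exists_lift q (1 : A →* A) 1 (by simp) (by simp)
      have h1 : TransvEquiv x' (Fin.cons (a' 0) u : Fin (k + 2) → A) := by
        have := hu.cons (a' 0)
        rwa [← hx', Fin.cons_self_tail, hx'] at this
      have h2 : TransvEquiv (Fin.cons (a' 0) u : Fin (k + 2) → A)
          (Fin.cons (a' 0) (Fin.tail y')) := by
        -- The remaining discrepancies are powers of the common entry `0`, so one transvection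
        -- repairs each.
        refine rel_of_forall_update (fun u v => TransvEquiv (Fin.cons (a' 0) u : Fin (k + 2) → A)
          (Fin.cons (a' 0) v)) (fun _ => .refl _) (fun _ _ _ => .trans) u (Fin.tail y') ?_
        intro z i _ hzi
        have hmem : (z i)⁻¹ * Fin.tail y' i ∈ Subgroup.zpowers (a' 0) := by
          rw [hzi, ← QuotientGroup.eq]
          exact congrFun huy i
        obtain ⟨c, hc⟩ := Subgroup.mem_zpowers_iff.1 hmem
        refine TransvMove.equiv ⟨i.succ, 0, Fin.succ_ne_zero i, c, ?_⟩
        rw [Fin.cons_update]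
        simp [hc]
      have h3 : (Fin.cons (a' 0) (Fin.tail y') : Fin (k + 2) → A) = y' := by
        rw [← hy', Fin.cons_self_tail]
      rw [h3] at h2
      exact ((hxx'.trans h1).trans h2).trans hyy'.symm
    · push Not at h
      refine trivial_case fun b => ?_
      have hpow : ∀ b : A, ∃ c, c ^ p = b := by
        have : (powMonoidHom p : A →* A).range = ⊤ := by
          rw [eq_top_iff, ← ha, Subgroup.closure_le]
          rintro _ ⟨i, rfl⟩
          exact h i
        exact fun b => MonoidHom.range_eq_top.1 this b
      have hpow' : ∀ m : ℕ, ∃ c, c ^ p ^ m = b := by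
        intro m
        induction m with
        | zero => exact ⟨b, by simp⟩
        | succ m ihm =>
          obtain ⟨c, rfl⟩ := ihm
          obtain ⟨d, rfl⟩ := hpow c
          exact ⟨d, by rw [pow_succ', pow_mul]⟩
      obtain ⟨c, rfl⟩ := hpow' e
      exact hA c

/-- If an abelian group of finite exponent is generated by `k` elements, then any two
generating `(k + 1)`-tuples are equivalent. -/
theorem transvEquiv_of_exponent {n : ℕ} (hn : n ≠ 0) {A : Type*} [CommGroup A]
    (hA : ∀ a : A, a ^ n = 1) {k : ℕ} {a : Fin k → A}
    (ha : Subgroup.closure (Set.range a) = ⊤) {x y : Fin (k + 1) → A}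
    (hx : Subgroup.closure (Set.range x) = ⊤) (hy : Subgroup.closure (Set.range y) = ⊤) :
    TransvEquiv x y := by
  induction n using Nat.recOnPosPrimePosCoprime generalizing A with
  | zero => exact absurd rfl hn
  | one =>
    have : x = y := funext fun l => by
      rw [← pow_one (x l), ← pow_one (y l), hA, hA]
    exact this ▸ .refl _
  | prime_pow p e hp _ => exact transvEquiv_of_prime_pow hp hA ha hx hy
  | coprime b c hb hc hbc ihb ihc =>
    obtain ⟨u, v, huv⟩ : IsCoprime (b : ℤ) (c : ℤ) := Nat.isCoprime_iff_coprime.2 hbc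
    have hA' : ∀ z : A, z ^ ((b : ℤ) * c) = 1 := fun z => by exact_mod_cast hA z
    -- `f` kills the `c`-torsion and `g` the `b`-torsion. By Bézout, the power `v * c` is invisible
    -- to `f` and killed by `g`, and `u * b` behaves the opposite way, so the two images can be
    -- adjusted independently.
    set f := QuotientGroup.mk' (powMonoidHom c : A →* A).ker with hf
    set g := QuotientGroup.mk' (powMonoidHom b : A →* A).ker with hg
    have hfone : ∀ z : A, f z = 1 ↔ z ^ c = 1 := fun z => by
      rw [← MonoidHom.mem_ker, hf, QuotientGroup.ker_mk', MonoidHom.mem_ker, powMonoidHom_apply]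
    have hgone : ∀ z : A, g z = 1 ↔ z ^ b = 1 := fun z => by
      rw [← MonoidHom.mem_ker, hg, QuotientGroup.ker_mk', MonoidHom.mem_ker, powMonoidHom_apply]
    have hfz : ∀ (z : A) (s : ℤ), (b : ℤ) ∣ s → f (z ^ s) = 1 := fun z s hs => by
      rw [hfone, ← zpow_natCast, ← zpow_mul, ← zpow_zero z]
      exact zpow_eq_of_dvd_sub (hA' z) (by simpa using mul_dvd_mul_right hs (c : ℤ))
    have hgz : ∀ (z : A) (s : ℤ), (c : ℤ) ∣ s → g (z ^ s) = 1 := fun z s hs => by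
      rw [hgone, ← zpow_natCast, ← zpow_mul, ← zpow_zero z]
      refine zpow_eq_of_dvd_sub (hA' z) ?_
      simpa [mul_comm] using mul_dvd_mul_left (b : ℤ) hs
    have hsplit : ∀ z : A, z ^ (u * b : ℤ) * z ^ (v * c : ℤ) = z := fun z => by
      rw [← zpow_add, huv, zpow_one]
    have hfid : ∀ z, f (z ^ (v * c : ℤ)) = f z := fun z => by
      conv_rhs => rw [← hsplit z, map_mul, hfz z _ ⟨u, mul_comm _ _⟩, one_mul]
    have hgid : ∀ z, g (z ^ (u * b : ℤ)) = g z := fun z => by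
      conv_rhs => rw [← hsplit z, map_mul, hgz z (v * c) ⟨v, mul_comm _ _⟩, mul_one]
    have hgen : ∀ {m : ℕ} {Q : Type _} [Group Q] (φ : A →* Q) (_ : Surjective φ) {t : Fin m → A},
        Subgroup.closure (Set.range t) = ⊤ → Subgroup.closure (Set.range (φ ∘ t)) = ⊤ := by
      intro m Q _ φ hφ t ht
      rw [Set.range_comp, ← MonoidHom.map_closure, ht, Subgroup.map_top_of_surjective φ hφ]
    have hfs : Surjective f := QuotientGroup.mk'_surjective _
    have hgs : Surjective g := QuotientGroup.mk'_surjective _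
    have hB : TransvEquiv (f ∘ x) (f ∘ y) := by
      refine ihb (by omega) (fun w => ?_) (hgen f hfs ha) (hgen f hfs hx) (hgen f hfs hy)
      obtain ⟨w, rfl⟩ := hfs w
      rw [← map_pow, ← zpow_natCast]
      exact hfz w b dvd_rfl
    obtain ⟨x', hxx', hfx', hgx'⟩ := hB.exists_lift f g (v * c) hfid
      (fun z => hgz z _ ⟨v, mul_comm _ _⟩)
    have hC : TransvEquiv (g ∘ x') (g ∘ y) := by
      rw [hgx']
      refine ihc (by omega) (fun w => ?_) (hgen g hgs ha) (hgen g hgs hx) (hgen g hgs hy)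
      obtain ⟨w, rfl⟩ := hgs w
      rw [← map_pow, ← zpow_natCast]
      exact hgz w c dvd_rfl
    obtain ⟨x'', hxx'', hgx'', hfx''⟩ := hC.exists_lift g f (u * b) hgid
      (fun z => hfz z _ ⟨u, mul_comm _ _⟩)
    -- The quotient of corresponding entries has order dividing both `b` and `c`.
    have heq : x'' = y := funext fun l => by
      have h1 : f (x'' l * (y l)⁻¹) = 1 := by
        rw [map_mul, map_inv, mul_inv_eq_one]
        exact congrFun (hfx''.trans hfx') l
      have h2 : g (x'' l * (y l)⁻¹) = 1 := by
        rw [map_mul, map_inv, mul_inv_eq_one]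
        exact congrFun hgx'' l
      rw [hfone] at h1
      rw [hgone] at h2
      rw [← mul_inv_eq_one, ← pow_one (x'' l * (y l)⁻¹), ← hbc.gcd_eq_one, pow_gcd_eq_one]
      exact ⟨h2, h1⟩
    exact heq ▸ hxx'.trans hxx''

/-! ### From equivalence of tuples to connectedness of graphs -/

section Graph

variable {G : Type*} [Group G] {k : ℕ}

theorem acEquiv_of_reachable {N : Subgroup G} {x y : ACVertex k N}
    (h : (acGraph k N).Reachable x y) : ACEquiv x.1 y.1 := by
  rw [SimpleGraph.reachable_iff_reflTransGen] at h
  induction h with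
  | refl => exact .refl _
  | tail _ ha ih =>
    rw [acGraph, SimpleGraph.fromRel_adj] at ha
    exact ih.trans (ha.2.elim ACMove.equiv fun h => h.symm.equiv)

theorem reachable_of_acMove {N : Subgroup G} {x y : ACVertex k N} (h : ACMove x.1 y.1) :
    (acGraph k N).Reachable x y := by
  by_cases hxy : x = y
  · exact hxy ▸ .refl _
  · refine SimpleGraph.Adj.reachable ?_
    rw [acGraph, SimpleGraph.fromRel_adj]
    exact ⟨hxy, .inl h⟩

/-- Moves preserve the normal closure, so every intermediate tuple of a chain is itself a vertex. -/
theorem reachable_of_acEquiv {N : Subgroup G} {x y : ACVertex k N} (h : ACEquiv x.1 y.1) :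
    (acGraph k N).Reachable x y := by
  obtain ⟨y, hy⟩ := y
  replace h : ACEquiv x.1 y := h
  induction h with
  | refl => exact .refl _
  | tail _ hm ih =>
    exact (ih (hm.normalClosure_eq.symm.trans hy)).trans (reachable_of_acMove hm)

/-- A chain cannot leave the preimage of `C`, because its image in the abelianization is again a
chain of moves. -/
theorem reachable_induce_of_acEquiv
    {C : (acGraph k (⊤ : Subgroup (Abelianization G))).ConnectedComponent}
    {x y : acAbelianize k ⁻¹' C.supp} (h : ACEquiv x.1.1 y.1.1) :
    ((acGraph k (⊤ : Subgroup G)).induce (acAbelianize k ⁻¹' C.supp)).Reachable x y := by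
  obtain ⟨⟨y, hy⟩, hyC⟩ := y
  replace h : ACEquiv x.1.1 y := h
  induction h with
  | refl => exact .refl _
  | @tail z y _ hm ih =>
    have hz : Subgroup.normalClosure (Set.range z) = ⊤ := hm.normalClosure_eq.symm.trans hy
    have hzy : (acGraph k (⊤ : Subgroup (Abelianization G))).Reachable
        (acAbelianize k ⟨z, hz⟩) (acAbelianize k ⟨y, hy⟩) :=
      reachable_of_acMove (hm.map Abelianization.of)
    have hzC : (acGraph k (⊤ : Subgroup (Abelianization G))).connectedComponentMk
        (acAbelianize k ⟨z, hz⟩) = C :=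
      (SimpleGraph.ConnectedComponent.sound hzy).trans hyC
    refine (ih hz hzC).trans ?_
    by_cases hzy : z = y
    · subst hzy
      exact .refl _
    · refine SimpleGraph.Adj.reachable ?_
      rw [SimpleGraph.induce_adj, acGraph, SimpleGraph.fromRel_adj]
      exact ⟨fun h => hzy (congrArg Subtype.val h), .inl hm⟩

end Graph

theorem closure_eq_top_of_normalClosure {A : Type*} [CommGroup A] {s : Set A}
    (h : Subgroup.normalClosure s = ⊤) : Subgroup.closure s = ⊤ := by
  rw [eq_top_iff, ← h]
  exact Subgroup.normalClosure_le_normal Subgroup.subset_closure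

theorem abelianization_of_surjective {G : Type*} [Group G] :
    Surjective (Abelianization.of : G →* Abelianization G) :=
  Quotient.mk_surjective

/-- In a finite soluble group generated by `k` elements, `k`-tuples that generate the group as a
normal subgroup are equivalent as soon as their images in the abelianization are. -/
theorem acEquiv_of_abelianize {G : Type*} [Group G] [Finite G] [Group.IsSolvable G] {k : ℕ}
    (hk : ∃ g : Fin k → G, Subgroup.closure (Set.range g) = ⊤)
    {x y : ACVertex k (⊤ : Subgroup G)}
    (h : ACEquiv (acAbelianize k x).1 (acAbelianize k y).1) : ACEquiv x.1 y.1 := by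
  -- Neither `x` nor `y` need generate `G` as a group, so both are compared with a generating lift
  -- `t` of the image of `y`.
  obtain ⟨t, ht, htop⟩ := exists_generating_lift abelianization_of_surjective hk
    (closure_eq_top_of_normalClosure (acAbelianize k y).2)
  obtain ⟨x', hx, hx'⟩ := ACEquiv.exists_lift (x := x.1) abelianization_of_surjective h
  have h1 : ACEquiv x' t := acEquiv_of_generating t x' htop (hx'.trans ht.symm)
  have h2 : ACEquiv y.1 t := acEquiv_of_generating t y.1 htop ht.symm
  exact (hx.trans h1).trans h2.symm

end AndrewsCurtis

theorem mainTheorem2 {G : Type*} [Group G] [Finite G] [Group.IsSolvable G] (k : ℕ)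
    (hk : ∃ g : Fin k → G, Subgroup.closure (Set.range g) = ⊤) :
    (∀ C : (AndrewsCurtis.acGraph k (⊤ : Subgroup (Abelianization G))).ConnectedComponent,
      ((AndrewsCurtis.acGraph k (⊤ : Subgroup G)).induce
        (AndrewsCurtis.acAbelianize k ⁻¹' C.supp)).Connected) ∧
    (AndrewsCurtis.acGraph (k + 1) (⊤ : Subgroup G)).Connected := by
  open AndrewsCurtis in
  constructor
  · intro C
    obtain ⟨v, rfl⟩ := C.exists_rep
    obtain ⟨t, ht, htop⟩ := exists_generating_lift abelianization_of_surjective hk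
      (closure_eq_top_of_normalClosure v.2)
    have htn : Subgroup.normalClosure (Set.range t) = ⊤ := by
      rw [eq_top_iff, ← htop]
      exact Subgroup.closure_le_normalClosure
    rw [SimpleGraph.connected_iff]
    refine ⟨fun x y => ?_, ⟨⟨⟨t, htn⟩, ?_⟩⟩⟩
    · refine reachable_induce_of_acEquiv (acEquiv_of_abelianize hk (acEquiv_of_reachable ?_))
      exact SimpleGraph.ConnectedComponent.exact (Eq.trans x.2 (Eq.symm y.2))
    · have : acAbelianize k ⟨t, htn⟩ = v := Subtype.ext ht
      exact congrArg (acGraph k (⊤ : Subgroup (Abelianization G))).connectedComponentMk this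
  · obtain ⟨g, hg⟩ := hk
    -- Padding by `1` supplies the `k + 1` generators needed for lifting; the abelianization still
    -- has `k` generators, one fewer than the tuple length.
    have hg' : Subgroup.closure (Set.range (Fin.cons 1 g : Fin (k + 1) → G)) = ⊤ := by
      rw [eq_top_iff, ← hg]
      refine Subgroup.closure_mono ?_
      rintro _ ⟨i, rfl⟩
      exact ⟨i.succ, by simp⟩
    rw [SimpleGraph.connected_iff]
    refine ⟨fun x y => reachable_of_acEquiv (acEquiv_of_abelianize ⟨_, hg'⟩ ?_), ⟨⟨Fin.cons 1 g, ?_⟩⟩⟩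
    · have hab : Subgroup.closure (Set.range (Abelianization.of ∘ g)) = ⊤ := by
        rw [Set.range_comp, ← MonoidHom.map_closure, hg,
          Subgroup.map_top_of_surjective _ abelianization_of_surjective]
      exact (transvEquiv_of_exponent (Nat.card_pos (α := Abelianization G)).ne'
        (fun _ => pow_card_eq_one') hab (closure_eq_top_of_normalClosure (acAbelianize _ x).2)
        (closure_eq_top_of_normalClosure (acAbelianize _ y).2)).acEquiv
    · rw [eq_top_iff, ← hg']
      exact Subgroup.closure_le_normalClosure
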